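/- **Setting.** For $p\in\mathbb R^3$ put $p^0=\sqrt{1+|p|^2}$ and $p^\mu=(p^0,p)$, and use the Lorentz product $a^\mu b_\mu=-a^0b^0+\sum_{i=1}^3a^ib^i$. For $p,q\in\mathbb R^3$ and $\omega\in\mathbb S^2$ set $$s=-(p^\mu+q^\mu)(p_\mu+q_\mu),\quad g=\sqrt{(p^\mu-q^\mu)(p_\mu-q_\mu)},\quad v_{\mathrm M}=\frac{g\sqrt s}{p^0q^0},\quad \gamma=\frac{p^0+q^0}{\sqrt s},$$ $$p'=\frac{p+q}2+\frac g2\Big(\omega+(\gamma-1)(p+q)\frac{(p+q)\cdot\omega}{|p+q|^2}\Big),\qquad q'=\frac{p+q}2-\frac g2\Big(\omega+(\gamma-1)(p+q)\frac{(p+q)\cdot\omega}{|p+q|^2}\Big),$$ (the bracket being $\omega$ if $p+q=0$), and let $\theta\in[0,\pi]$ be given by $\cos\theta=(p^\mu-q^\mu)(p'_\mu-q'_\mu)/g^2$. Let the measurable scattering kernel satisfy $\sigma(g,\theta)\approx g\,\sigma_0(\theta)$, that is, $A^{-1}g\sigma_0(\theta)\le\sigma(g,\theta)\le A\,g\sigma_0(\theta)$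 for all $g\ge0$, $\theta\in[0,\pi]$, where $A>0$ and $\sigma_0$ is measurable with $0\le\sigma_0\le M$ on $[0,\pi]$, $M>0$. For non-negative measurable $f,h$ on $[0,1]\times\mathbb R^3$ the gain term is $$Q^+(f,h)(x_1,p)=\int_{\mathbb R^3}\int_{\mathbb S^2}v_{\mathrm M}\,\sigma(g,\theta)\,f(x_1,p')\,h(x_1,q')\,d\omega\,dq\in[0,\infty].$$ For $k>0$ let $\varphi(p)=e^{kp^0}$, let $\|f(\cdot,p)\|_{L^\infty_{x_1}}=\operatorname{ess\,sup}_{x_1\in[0,1]}|f(x_1,p)|$, and $$\|f\|=\int_{\mathbb R^3}(p^0)^{1/2}\varphi(p)\|f(\cdot,p)\|_{L^\infty_{x_1}}dp,\qquad \|f\|_{-1}=\sup_{a\in\mathbb R^3}\int_{\mathbb R^3}\frac{(p^0)^{1/2}\varphi(p)}{|p-a|}\|f(\cdot,p)\|_{L^\infty_{x_1}}dp .$$ **Statement (Lemma 3.2 and Corollary 3.3).** There is a constant $C>0$, depending only on $A$ and $M$, such that for all such $\sigma,\sigma_0$, all $k>0$, and all non-negative measurable $f,h$ on $[0,1]\times\mathbb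 R^3$, $$\int_{\mathbb R^3}\varphi(p)\,\|Q^+(f,h)(\cdot,p)\|_{L^\infty_{x_1}}\,dp\le \frac Ck\,\|f\|_{-1}\,\|h\|$$ and $$\int_{\mathbb R^3}\varphi(p)\,\|Q^+(f,h)(\cdot,p)\|_{L^\infty_{x_1}}\,dp\le \frac Ck\,\|h\|_{-1}\,\|f\| .$$ All quantities take values in $[0,\infty]$, with $0\cdot\infty=0$. -/

import Mathlib

open MeasureTheory
open scoped ENNReal

noncomputable section

namespace RelBoltzmann

/-- The momentum space `ℝ³` with its Euclidean structure. -/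
abbrev Mom : Type := EuclideanSpace ℝ (Fin 3)

/-- The unit sphere of `ℝ³`. -/
abbrev S2 : Type := Metric.sphere (0 : Mom) 1

/-- The surface measure `dω` on the unit sphere (of total mass `4π`). -/
def sphereMeasure : Measure S2 := (volume : Measure Mom).toSphere

/-- The particle energy `p⁰ = √(1 + |p|²)` (with `c = m = 1`). -/
def energy (p : Mom) : ℝ := Real.sqrt (1 + ‖p‖ ^ 2)

/-- The energy-momentum vector `(p⁰, p)`. -/
def fourMomentum (p : Mom) : ℝ × Mom := (energy p, p)

/-- The Lorentz inner product of two four-vectors, of signature `(-,+,+,+)`. -/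
def lorentzInner (a b : ℝ × Mom) : ℝ := -(a.1 * b.1) + inner ℝ a.2 b.2

/-- The square of the total energy in the center-of-momentum frame. -/
def sVar (p q : Mom) : ℝ :=
  -lorentzInner (fourMomentum p + fourMomentum q) (fourMomentum p + fourMomentum q)

/-- The relative momentum. -/
def gVar (p q : Mom) : ℝ :=
  Real.sqrt (lorentzInner (fourMomentum p - fourMomentum q) (fourMomentum p - fourMomentum q))

/-- The Møller velocity `g √s / (p⁰ q⁰)`. -/
def mollerVelocity (p q : Mom) : ℝ :=
  gVar p q * Real.sqrt (sVar p q) / (energy p * energy q)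

/-- The Lorentz factor `γ = (p⁰ + q⁰) / √s`. -/
def lorentzFactor (p q : Mom) : ℝ := (energy p + energy q) / Real.sqrt (sVar p q)

/-- `ω + (γ - 1) (p + q) ((p + q) · ω) / |p + q|²`. For `p + q = 0` one has `γ = 1` and this
is `ω`, in agreement with the convention for division by zero. -/
def boostedDirection (p q : Mom) (ω : S2) : Mom :=
  (ω : Mom) +
    ((lorentzFactor p q - 1) * (inner ℝ (p + q) (ω : Mom) / ‖p + q‖ ^ 2)) • (p + q)

/-- The post-collisional momentum `p'`. -/
def postP (p q : Mom) (ω : S2) : Mom :=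
  (1 / 2 : ℝ) • (p + q) + (gVar p q / 2) • boostedDirection p q ω

/-- The post-collisional momentum `q'`. -/
def postQ (p q : Mom) (ω : S2) : Mom :=
  (1 / 2 : ℝ) • (p + q) - (gVar p q / 2) • boostedDirection p q ω

/-- The scattering angle `θ ∈ [0, π]`, given by
`cos θ = (p^μ - q^μ)(p'_μ - q'_μ) / g²`. For `g = 0`, that is `p = q`, its value plays no role
in the collision operator. -/
def scatteringAngle (p q : Mom) (ω : S2) : ℝ :=
  Real.arccos (lorentzInner (fourMomentum p - fourMomentum q)
    (fourMomentum (postP p q ω) - fourMomentum (postQ p q ω)) / gVar p q ^ 2)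

/-- The relativistic hard-sphere assumption with angular cutoff: `σ(g, θ) ≈ g σ₀(θ)` with
comparison constant `A`, where `0 ≤ σ₀ ≤ M`. -/
structure IsHardSphereKernel (A M : ℝ) (σ : ℝ → ℝ → ℝ) (σ₀ : ℝ → ℝ) : Prop where
  measurable_kernel : Measurable (Function.uncurry σ)
  measurable_angular : Measurable σ₀
  angular_nonneg : ∀ θ ∈ Set.Icc 0 Real.pi, 0 ≤ σ₀ θ
  angular_le : ∀ θ ∈ Set.Icc 0 Real.pi, σ₀ θ ≤ M
  lower : ∀ g, 0 ≤ g → ∀ θ ∈ Set.Icc 0 Real.pi, g * σ₀ θ ≤ A * σ g θ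
  upper : ∀ g, 0 ≤ g → ∀ θ ∈ Set.Icc 0 Real.pi, σ g θ ≤ A * (g * σ₀ θ)

/-- The gain term `Q⁺(f, h)(x₁, p)` in the center-of-momentum representation, for non-negative
`f` and `h`; it takes values in `[0, ∞]`. -/
def gain (σ : ℝ → ℝ → ℝ) (f h : unitInterval → Mom → ℝ) (x : unitInterval) (p : Mom) : ℝ≥0∞ :=
  ∫⁻ q : Mom, ∫⁻ ω : S2,
    ENNReal.ofReal (mollerVelocity p q * σ (gVar p q) (scatteringAngle p q ω) *
      (f x (postP p q ω) * h x (postQ p q ω))) ∂sphereMeasure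

/-- The norm `‖f(·, p)‖_{L^∞_{x₁}}`, the essential supremum of `|f(x₁, p)|` over
`x₁ ∈ [0, 1]`. -/
def supNorm {ε : Type*} [ENorm ε] (f : unitInterval → Mom → ε) (p : Mom) : ℝ≥0∞ :=
  eLpNorm (fun x : unitInterval => f x p) ∞ volume

/-- The exponential weight `φ(p) = exp (k p⁰)`. -/
def expWeight (k : ℝ) (p : Mom) : ℝ := Real.exp (k * energy p)

/-- The norm `‖f‖ = ∫ ‖f(·, p)‖_{L^∞_{x₁}} (p⁰)^{1/2} φ(p) dp`. -/
def weightedNorm (k : ℝ) (f : unitInterval → Mom → ℝ) : ℝ≥0∞ :=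
  ∫⁻ p : Mom, ENNReal.ofReal (Real.sqrt (energy p) * expWeight k p) * supNorm f p

/-- The norm `‖f‖₋₁ = sup_a ∫ (p⁰)^{1/2} φ(p) |p - a|⁻¹ ‖f(·, p)‖_{L^∞_{x₁}} dp`. -/
def negNorm (k : ℝ) (f : unitInterval → Mom → ℝ) : ℝ≥0∞ :=
  ⨆ a : Mom, ∫⁻ p : Mom,
    ENNReal.ofReal (Real.sqrt (energy p) * expWeight k p / ‖p - a‖) * supNorm f p

end RelBoltzmann

end

/-!
In the variables `P = p + q` and `u`, the momentum of the first particle in the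
center-of-momentum frame, a collision keeps `P` and replaces `u` by `|u| ω`. The Jacobian of
`(P, u) ↦ (p, q)` times the Møller velocity is `8 |u| / (p⁰ + q⁰)`, which depends on `u` only
through `|u|`; hence the collision measure `v_M dω dq dp` is invariant under the exchange of
the pairs `(p, q)` and `(p', q')`, and the weight may be moved from `p` to `p'`.

There `p'⁰ = (p⁰ + q⁰) / 2 + c (p + q) · ω` with `c = g / (2 √s) ≤ 1 / 2`, so the integral over the
sphere is that of `exp (v · ω)` with `v = k c (p + q)`. Up to a constant this is at most
`exp |v| / |v|`, because the mass concentrates in a cap of width `|v|^(-1/2)` around the direction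
of `v`; extending the integrand to the unit ball, it is dominated there by a Gaussian of that width
in the directions orthogonal to `v`. Since `|v| ≤ k (p⁰ + q⁰) / 2`, this gives
`φ(p) φ(q) / (k c |p + q|)`, and the factor `v_M g` absorbs `1 / c`.
-/

noncomputable section

namespace RelBoltzmann

open scoped InnerProductSpace

section Polar

variable {E : Type*} [NormedAddCommGroup E] [NormedSpace ℝ E] [FiniteDimensional ℝ E]
  [Nontrivial E]

lemma volumeIoiPow_finrank_Iio_one :
    Measure.volumeIoiPow (Module.finrank ℝ E - 1) (Set.Iio ⟨1, Set.mem_Ioi.2 one_pos⟩)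
      = (Module.finrank ℝ E : ℝ≥0∞)⁻¹ := by
  have hdim : 0 < Module.finrank ℝ E := Module.finrank_pos
  rw [Measure.volumeIoiPow_apply_Iio, one_pow, one_div, Nat.cast_pred hdim, sub_add_cancel,
    ENNReal.ofReal_inv_of_pos (by exact_mod_cast hdim), ENNReal.ofReal_natCast]

variable [MeasurableSpace E] [BorelSpace E] (μ : Measure E) [μ.IsAddHaarMeasure]

lemma lintegral_eq_lintegral_toSphere {X : E → ℝ≥0∞} (hX : Measurable X) :
    ∫⁻ u, X u ∂μ = ∫⁻ ω, ∫⁻ r : Set.Ioi (0 : ℝ), X (r.1 • (ω : E))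
      ∂(Measure.volumeIoiPow (Module.finrank ℝ E - 1)) ∂μ.toSphere := by
  have hm : Measurable fun z : Metric.sphere (0 : E) 1 × Set.Ioi (0 : ℝ) =>
    X (z.2.1 • (z.1 : E)) := by fun_prop
  calc ∫⁻ u, X u ∂μ = ∫⁻ u : ({0}ᶜ : Set E), X u ∂(μ.comap Subtype.val) := by
        rw [lintegral_subtype_comap (measurableSet_singleton (0 : E)).compl,
          restrict_compl_singleton]
    _ = ∫⁻ u : ({0}ᶜ : Set E), X ((homeomorphUnitSphereProd E u).2.1 •
          ((homeomorphUnitSphereProd E u).1 : E)) ∂(μ.comap Subtype.val) := by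
        refine lintegral_congr fun u => ?_
        simp [norm_ne_zero_iff.2 u.2]
    _ = _ := by
        rw [μ.measurePreserving_homeomorphUnitSphereProd.lintegral_comp hm, lintegral_prod _
          hm.aemeasurable]

lemma lintegral_toSphere_norm_smul {X : E → E → ℝ≥0∞} (hX : Measurable (Function.uncurry X)) :
    ∫⁻ u, ∫⁻ ω, X u (‖u‖ • (ω : E)) ∂μ.toSphere ∂μ
      = ∫⁻ r : Set.Ioi (0 : ℝ), ∫⁻ ω, ∫⁻ ω', X (r.1 • (ω : E)) (r.1 • (ω' : E))
          ∂μ.toSphere ∂μ.toSphere ∂(Measure.volumeIoiPow (Module.finrank ℝ E - 1)) := by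
  have hm : Measurable fun u : E => ∫⁻ ω, X u (‖u‖ • (ω : E)) ∂μ.toSphere :=
    Measurable.lintegral_prod_right' (f := fun z : E × Metric.sphere (0 : E) 1 =>
      X z.1 (‖z.1‖ • (z.2 : E))) (hX.comp (f := fun z : E × Metric.sphere (0 : E) 1 =>
        (z.1, ‖z.1‖ • (z.2 : E))) (by fun_prop))
  rw [lintegral_eq_lintegral_toSphere μ hm, lintegral_lintegral_swap]
  · refine lintegral_congr fun r => lintegral_congr fun ω => lintegral_congr fun ω' => ?_
    rw [norm_smul, Real.norm_of_nonneg r.2.le, norm_eq_of_mem_sphere, mul_one]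
  · exact (hm.comp (g := fun u : E => _) (f := fun z : Metric.sphere (0 : E) 1 × Set.Ioi (0 : ℝ) =>
      z.2.1 • (z.1 : E)) (by fun_prop)).aemeasurable

lemma lintegral_toSphere_norm_smul_comm {X : E → E → ℝ≥0∞}
    (hX : Measurable (Function.uncurry X)) :
    ∫⁻ u, ∫⁻ ω, X u (‖u‖ • (ω : E)) ∂μ.toSphere ∂μ
      = ∫⁻ u, ∫⁻ ω, X (‖u‖ • (ω : E)) u ∂μ.toSphere ∂μ := by
  rw [lintegral_toSphere_norm_smul μ hX,
    lintegral_toSphere_norm_smul μ (X := fun u v => X v u) (hX.comp measurable_swap)]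
  refine lintegral_congr fun r => lintegral_lintegral_swap ?_
  exact (hX.comp (f := fun z : Metric.sphere (0 : E) 1 × Metric.sphere (0 : E) 1 =>
    (r.1 • (z.1 : E), r.1 • (z.2 : E))) (by fun_prop)).aemeasurable

lemma lintegral_toSphere_le {Y : Metric.sphere (0 : E) 1 → ℝ≥0∞} {G : E → ℝ≥0∞}
    (hG : Measurable G) (hYG : ∀ ω, ∀ r : ℝ, 0 < r → r < 1 → Y ω ≤ G (r • (ω : E))) :
    ∫⁻ ω, Y ω ∂μ.toSphere ≤ Module.finrank ℝ E * ∫⁻ u, G u ∂μ := by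
  have hdim : (Module.finrank ℝ E : ℝ≥0∞) ≠ 0 := by exact_mod_cast Module.finrank_pos.ne'
  rw [lintegral_eq_lintegral_toSphere μ hG,
    ← lintegral_const_mul' _ _ (ENNReal.natCast_ne_top _)]
  refine lintegral_mono fun ω => ?_
  set ball : Set (Set.Ioi (0 : ℝ)) := Set.Iio ⟨1, Set.mem_Ioi.2 one_pos⟩
  calc Y ω = Module.finrank ℝ E * ∫⁻ _ in ball, Y ω
        ∂(Measure.volumeIoiPow (Module.finrank ℝ E - 1)) := by
        rw [setLIntegral_const, volumeIoiPow_finrank_Iio_one, mul_left_comm,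
          ENNReal.mul_inv_cancel hdim (ENNReal.natCast_ne_top _), mul_one]
    _ ≤ Module.finrank ℝ E * ∫⁻ r in ball, G (r.1 • (ω : E))
        ∂(Measure.volumeIoiPow (Module.finrank ℝ E - 1)) := by
        gcongr Module.finrank ℝ E * ?_
        exact setLIntegral_mono' measurableSet_Iio fun r hr => hYG ω r.1 r.2 hr
    _ ≤ _ := by gcongr Module.finrank ℝ E * ?_; exact setLIntegral_le_lintegral _ _

end Polar

section SphereExponential

variable {V : Type*} [NormedAddCommGroup V] [InnerProductSpace ℝ V]

/-- The linear map which fixes the unit vector `e` and is multiplication by `b` on its orthogonal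
complement; it is written as a multiple of a transvection, whose determinant is known. -/
def transverseDilation (b : ℝ) (e : V) : V →ₗ[ℝ] V :=
  b • LinearMap.transvection ((b⁻¹ - 1) • innerₛₗ ℝ e) e

lemma transverseDilation_apply {b : ℝ} (hb : b ≠ 0) (e v : V) :
    transverseDilation b e v = b • v + ((1 - b) * ⟪e, v⟫_ℝ) • e := by
  simp only [transverseDilation, LinearMap.smul_apply, LinearMap.transvection.apply, smul_add,
    smul_smul, innerₛₗ_apply_apply, smul_eq_mul]
  congr 2
  field_simp

lemma norm_transverseDilation_sq {b : ℝ} (hb : b ≠ 0) {e : V} (he : ‖e‖ = 1) (v : V) :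
    ‖transverseDilation b e v‖ ^ 2 = b ^ 2 * (‖v‖ ^ 2 - ⟪e, v⟫_ℝ ^ 2) + ⟪e, v⟫_ℝ ^ 2 := by
  rw [transverseDilation_apply hb, norm_add_sq_real, norm_smul, norm_smul, he, inner_smul_left,
    inner_smul_right, real_inner_comm, mul_one, mul_pow, Real.norm_eq_abs, Real.norm_eq_abs,
    sq_abs, sq_abs]
  simp only [conj_trivial]
  ring

lemma mul_inner_le_of_norm_eq_one {β : ℝ} (hβ : 0 < β) {e ω : V} (he : ‖e‖ = 1) (hω : ‖ω‖ = 1)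
    {r : ℝ} (hr : 0 ≤ r) (hr1 : r ≤ 1) :
    β * ⟪e, ω⟫_ℝ ≤ β + 1 / 2 - 1 / 2 * ‖transverseDilation (√β) e (r • ω)‖ ^ 2 := by
  have ht := abs_real_inner_le_norm e ω
  rw [he, hω, mul_one, abs_le] at ht
  rw [norm_transverseDilation_sq (Real.sqrt_pos.2 hβ).ne' he, Real.sq_sqrt hβ.le, norm_smul, hω,
    inner_smul_right, mul_one, Real.norm_eq_abs, sq_abs]
  set t : ℝ := ⟪e, ω⟫_ℝ
  have hr2 : r ^ 2 ≤ 1 := pow_le_one₀ hr hr1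
  have ht2 : t ^ 2 ≤ 1 := by nlinarith
  have haxial : (r * t) ^ 2 ≤ 1 := by rw [mul_pow]; exact mul_le_one₀ hr2 (sq_nonneg t) ht2
  have htransverse : r ^ 2 - (r * t) ^ 2 ≤ 2 * (1 - t) := by
    nlinarith [sq_nonneg (1 - t), mul_le_mul_of_nonneg_right hr2 (sub_nonneg.2 ht2)]
  linarith [mul_le_mul_of_nonneg_left htransverse hβ.le]

variable [FiniteDimensional ℝ V]

lemma det_transverseDilation {b : ℝ} (hb : b ≠ 0) {e : V} (he : ‖e‖ = 1) :
    (transverseDilation b e).det = b ^ (Module.finrank ℝ V - 1) := by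
  have : Nontrivial V := ⟨e, 0, by rintro rfl; simp at he⟩
  rw [transverseDilation, LinearMap.det_smul, LinearMap.transvection.det]
  simp only [LinearMap.smul_apply, innerₛₗ_apply_apply, real_inner_self_eq_norm_sq, he, one_pow,
    smul_eq_mul, mul_one, add_sub_cancel]
  rw [← pow_sub_one_mul Module.finrank_pos.ne' b, mul_assoc, mul_inv_cancel₀ hb, mul_one]

variable [MeasurableSpace V] [BorelSpace V]

lemma integral_exp_neg_half_norm_sq_pos : 0 < ∫ v : V, Real.exp (-(1 / 2) * ‖v‖ ^ 2) := by
  rw [GaussianFourier.integral_rexp_neg_mul_sq_norm (by norm_num)]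
  positivity

lemma lintegral_gaussian_transverseDilation {b : ℝ} (hb : 0 < b) {e : V} (he : ‖e‖ = 1) :
    ∫⁻ v, ENNReal.ofReal (Real.exp (-(1 / 2) * ‖transverseDilation b e v‖ ^ 2))
      = ENNReal.ofReal
          ((∫ v : V, Real.exp (-(1 / 2) * ‖v‖ ^ 2)) / b ^ (Module.finrank ℝ V - 1)) := by
  have hint : Integrable fun v : V => Real.exp (-(1 / 2) * ‖v‖ ^ 2) :=
    not_imp_comm.1 integral_undef integral_exp_neg_half_norm_sq_pos.ne'
  have hdet := det_transverseDilation hb.ne' he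
  have hmeas : Measurable (transverseDilation b e) :=
    (LinearMap.continuous_of_finiteDimensional _).measurable
  rw [← lintegral_map (f := fun v => ENNReal.ofReal (Real.exp (-(1 / 2) * ‖v‖ ^ 2)))
      (by fun_prop) hmeas,
    Measure.map_linearMap_addHaar_eq_smul_addHaar _ (by rw [hdet]; positivity), hdet,
    lintegral_smul_measure, ← ofReal_integral_eq_lintegral_ofReal hint
      (Filter.Eventually.of_forall fun v => (Real.exp_pos _).le),
    abs_of_pos (by positivity), smul_eq_mul, ← ENNReal.ofReal_mul (by positivity), inv_mul_eq_div]

variable (V) in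
theorem exists_lintegral_toSphere_exp_inner_le :
    ∃ C : ℝ, 0 < C ∧ ∀ v : V, v ≠ 0 →
      ∫⁻ ω, ENNReal.ofReal (Real.exp ⟪v, (ω : V)⟫_ℝ) ∂(volume : Measure V).toSphere
        ≤ ENNReal.ofReal (C * (Real.exp ‖v‖ / √‖v‖ ^ (Module.finrank ℝ V - 1))) := by
  rcases subsingleton_or_nontrivial V with _ | _
  · exact ⟨1, one_pos, fun v hv => absurd (Subsingleton.elim v 0) hv⟩
  have hgauss := integral_exp_neg_half_norm_sq_pos (V := V)
  set n := Module.finrank ℝ V with hn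
  set I := ∫ v : V, Real.exp (-(1 / 2) * ‖v‖ ^ 2)
  have hn0 : 0 < n := Module.finrank_pos
  refine ⟨n * (Real.exp (1 / 2) * I), by positivity, fun v hv => ?_⟩
  have hβ : 0 < ‖v‖ := norm_pos_iff.2 hv
  set e := ‖v‖⁻¹ • v
  have he : ‖e‖ = 1 := norm_smul_inv_norm (𝕜 := ℝ) hv
  have hve : v = ‖v‖ • e := (smul_inv_smul₀ hβ.ne' v).symm
  have hmeas : Measurable (transverseDilation (√‖v‖) e) :=
    (LinearMap.continuous_of_finiteDimensional _).measurable
  calc _ ≤ n * ∫⁻ u, ENNReal.ofReal (Real.exp (‖v‖ + 1 / 2)) *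
        ENNReal.ofReal (Real.exp (-(1 / 2) * ‖transverseDilation (√‖v‖) e u‖ ^ 2)) := by
        refine lintegral_toSphere_le _ (by fun_prop) fun ω r hr hr1 => ?_
        rw [← ENNReal.ofReal_mul (Real.exp_pos _).le, ← Real.exp_add]
        refine ENNReal.ofReal_le_ofReal (Real.exp_le_exp.2 ?_)
        have h := mul_inner_le_of_norm_eq_one hβ he (norm_eq_of_mem_sphere ω) hr.le hr1.le
        rw [← real_inner_smul_left, ← hve] at h
        linarith
    _ = _ := by
        rw [lintegral_const_mul' _ _ ENNReal.ofReal_ne_top,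
          lintegral_gaussian_transverseDilation (Real.sqrt_pos.2 hβ) he, ← hn,
          ← ENNReal.ofReal_natCast, ← ENNReal.ofReal_mul (Real.exp_pos _).le,
          ← ENNReal.ofReal_mul (by positivity), Real.exp_add]
        congr 1
        ring

end SphereExponential

section Boost

section SystemEnergy

variable {V : Type*} [NormedAddCommGroup V]

/-- The energy `√(R² + |P|²)` of a system of invariant mass `R` and momentum `P`. -/
def systemEnergy (R : ℝ) (P : V) : ℝ := √(R ^ 2 + ‖P‖ ^ 2)

/-- The coefficient `1 / (R (R + E))`, with `E` the system energy, of the rank-one part of the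
boost; it equals `(γ - 1) / |P|²` with `γ = E / R`, but is regular at `P = 0`. -/
def boostCoeff (R : ℝ) (P : V) : ℝ := 1 / (R * (R + systemEnergy R P))

lemma systemEnergy_sq (R : ℝ) (P : V) : systemEnergy R P ^ 2 = R ^ 2 + ‖P‖ ^ 2 :=
  Real.sq_sqrt (by positivity)

lemma systemEnergy_nonneg (R : ℝ) (P : V) : 0 ≤ systemEnergy R P := Real.sqrt_nonneg _

lemma systemEnergy_pos {R : ℝ} (hR : 0 < R) (P : V) : 0 < systemEnergy R P :=
  Real.sqrt_pos.2 (by positivity)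

lemma norm_sq_eq_systemEnergy_sub_mul_add (R : ℝ) (P : V) :
    ‖P‖ ^ 2 = (systemEnergy R P - R) * (systemEnergy R P + R) := by
  linarith [systemEnergy_sq R P]

lemma norm_le_systemEnergy (R : ℝ) (P : V) : ‖P‖ ≤ systemEnergy R P :=
  Real.le_sqrt_of_sq_le (by linarith [sq_nonneg R])

lemma boostCoeff_mul_norm_sq {R : ℝ} (hR : 0 < R) (P : V) :
    boostCoeff R P * ‖P‖ ^ 2 = systemEnergy R P / R - 1 := by
  have hE := systemEnergy_pos hR P
  rw [norm_sq_eq_systemEnergy_sub_mul_add R P, boostCoeff]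
  field_simp
  ring

lemma hasDerivAt_boostCoeff {R : ℝ} (hR : 0 < R) (P : V) :
    HasDerivAt (fun R => boostCoeff R P) (-1 / (R ^ 2 * systemEnergy R P)) R := by
  have hE := systemEnergy_pos hR P
  have henergy : HasDerivAt (fun R => systemEnergy R P) (R / systemEnergy R P) R := by
    refine (((hasDerivAt_pow 2 R).add_const (‖P‖ ^ 2)).sqrt (by positivity)).congr_deriv ?_
    rw [← systemEnergy]
    field_simp
    norm_num
  have hprod : HasDerivAt (fun R => R * (R + systemEnergy R P))
      (1 * (R + systemEnergy R P) + R * (1 + R / systemEnergy R P)) R :=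
    (hasDerivAt_id R).mul ((hasDerivAt_id R).add henergy)
  simp only [boostCoeff, one_div]
  refine (hprod.fun_inv (by positivity)).congr_deriv ?_
  field_simp
  ring

end SystemEnergy

variable {V : Type*} [NormedAddCommGroup V] [InnerProductSpace ℝ V]

/-- The spatial part of the pure Lorentz boost that takes the four-vector `(R, 0)` to
`(systemEnergy R P, P)`, restricted to purely spatial vectors. -/
def boost (R : ℝ) (P : V) : V →ₗ[ℝ] V := LinearMap.transvection (boostCoeff R P • innerₛₗ ℝ P) P

/-- The inverse of `boost R P` for `0 < R`. -/
def boostInv (R : ℝ) (P : V) : V →ₗ[ℝ] V :=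
  LinearMap.transvection (-(1 / (systemEnergy R P * (R + systemEnergy R P))) • innerₛₗ ℝ P) P

lemma boost_apply (R : ℝ) (P v : V) : boost R P v = v + (boostCoeff R P * ⟪P, v⟫_ℝ) • P := rfl

lemma boostInv_apply (R : ℝ) (P v : V) : boostInv R P v
    = v + (-(1 / (systemEnergy R P * (R + systemEnergy R P))) * ⟪P, v⟫_ℝ) • P := rfl

variable {R : ℝ} (hR : 0 < R) (P v : V)
include hR

lemma inner_boost : ⟪P, boost R P v⟫_ℝ = systemEnergy R P / R * ⟪P, v⟫_ℝ := by
  rw [boost_apply, inner_add_right, inner_smul_right, real_inner_self_eq_norm_sq,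
    mul_right_comm, boostCoeff_mul_norm_sq hR]
  ring

lemma inner_boostInv : ⟪P, boostInv R P v⟫_ℝ = R / systemEnergy R P * ⟪P, v⟫_ℝ := by
  have hE := systemEnergy_pos hR P
  rw [boostInv_apply, inner_add_right, inner_smul_right, real_inner_self_eq_norm_sq,
    norm_sq_eq_systemEnergy_sub_mul_add R P]
  field_simp
  ring

lemma norm_boost_sq : ‖boost R P v‖ ^ 2 = ‖v‖ ^ 2 + (⟪P, v⟫_ℝ / R) ^ 2 := by
  have hE := systemEnergy_pos hR P
  rw [boost_apply, norm_add_sq_real, norm_smul, inner_smul_right, real_inner_comm, mul_pow,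
    norm_sq_eq_systemEnergy_sub_mul_add R P, Real.norm_eq_abs, sq_abs, boostCoeff]
  field_simp
  ring

lemma boost_boostInv : boost R P (boostInv R P v) = v := by
  have hE := systemEnergy_pos hR P
  rw [boost_apply, inner_boostInv hR, boostInv_apply, add_assoc, ← add_smul, boostCoeff]
  convert add_zero v using 2
  convert zero_smul ℝ P
  field_simp
  ring

lemma boostInv_boost : boostInv R P (boost R P v) = v := by
  have hE := systemEnergy_pos hR P
  rw [boostInv_apply, inner_boost hR, boost_apply, add_assoc, ← add_smul, boostCoeff]
  convert add_zero v using 2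
  convert zero_smul ℝ P
  field_simp
  ring

lemma norm_boostInv_sq :
    ‖boostInv R P v‖ ^ 2 = ‖v‖ ^ 2 - (⟪P, v⟫_ℝ / systemEnergy R P) ^ 2 := by
  have hE := systemEnergy_pos hR P
  have h := norm_boost_sq hR P (boostInv R P v)
  rw [boost_boostInv hR, inner_boostInv hR] at h
  rw [h]
  field_simp
  ring

end Boost

section Kinematics

lemma energy_sq (p : Mom) : energy p ^ 2 = 1 + ‖p‖ ^ 2 := Real.sq_sqrt (by positivity)

lemma energy_pos (p : Mom) : 0 < energy p := Real.sqrt_pos.2 (by positivity)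

lemma norm_le_energy (p : Mom) : ‖p‖ ≤ energy p := Real.le_sqrt_of_sq_le (by linarith)

lemma one_add_abs_inner_le (p q : Mom) : 1 + |⟪p, q⟫_ℝ| ≤ energy p * energy q := by
  refine (add_le_add_right (abs_real_inner_le_norm p q) 1).trans ?_
  refine abs_le_of_sq_le_sq' ?_ (mul_pos (energy_pos p) (energy_pos q)).le |>.2
  rw [mul_pow, energy_sq, energy_sq]
  nlinarith [sq_nonneg (‖p‖ - ‖q‖)]

lemma sVar_eq (p q : Mom) : sVar p q = (energy p + energy q) ^ 2 - ‖p + q‖ ^ 2 := by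
  simp only [sVar, lorentzInner, fourMomentum, Prod.fst_add, Prod.snd_add,
    real_inner_self_eq_norm_sq]
  ring

lemma sVar_eq_sub_inner (p q : Mom) : sVar p q = 2 + 2 * (energy p * energy q) - 2 * ⟪p, q⟫_ℝ := by
  rw [sVar_eq, norm_add_sq_real, add_sq, energy_sq, energy_sq]
  ring

lemma four_le_sVar (p q : Mom) : 4 ≤ sVar p q := by
  have := one_add_abs_inner_le p q
  rw [sVar_eq_sub_inner]
  linarith [le_abs_self ⟪p, q⟫_ℝ]

lemma sVar_pos (p q : Mom) : 0 < sVar p q := four_pos.trans_le (four_le_sVar p q)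

lemma sVar_le (p q : Mom) : sVar p q ≤ 4 * (energy p * energy q) := by
  have := one_add_abs_inner_le p q
  rw [sVar_eq_sub_inner]
  linarith [neg_abs_le ⟪p, q⟫_ℝ]

lemma norm_sub_sq_sub_energy_sub_sq (p q : Mom) :
    ‖p - q‖ ^ 2 - (energy p - energy q) ^ 2 = sVar p q - 4 := by
  rw [sVar_eq_sub_inner, norm_sub_sq_real, sub_sq, energy_sq, energy_sq]
  ring

lemma gVar_eq (p q : Mom) : gVar p q = √(sVar p q - 4) := by
  rw [← norm_sub_sq_sub_energy_sub_sq]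
  simp only [gVar, lorentzInner, fourMomentum, Prod.fst_sub, Prod.snd_sub,
    real_inner_self_eq_norm_sq]
  congr 1
  ring

lemma gVar_sq (p q : Mom) : gVar p q ^ 2 = sVar p q - 4 := by
  rw [gVar_eq, Real.sq_sqrt (by linarith [four_le_sVar p q])]

lemma gVar_nonneg (p q : Mom) : 0 ≤ gVar p q := Real.sqrt_nonneg _

lemma mollerVelocity_nonneg (p q : Mom) : 0 ≤ mollerVelocity p q :=
  div_nonneg (mul_nonneg (gVar_nonneg p q) (Real.sqrt_nonneg _))
    (mul_pos (energy_pos p) (energy_pos q)).le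

lemma systemEnergy_sqrt_sVar (p q : Mom) :
    systemEnergy (√(sVar p q)) (p + q) = energy p + energy q := by
  rw [systemEnergy, Real.sq_sqrt (sVar_pos p q).le, sVar_eq, sub_add_cancel,
    Real.sqrt_sq (add_pos (energy_pos p) (energy_pos q)).le]

/-- The momentum, for total momentum `P`, of the particle whose momentum in the
center-of-momentum frame is `u`; its partner has momentum `cmMap P (-u)`. The invariant mass of the
pair is `2 * energy u`. -/
def cmMap (P u : Mom) : Mom := (1 / 2 : ℝ) • P + boost (2 * energy u) P u

/-- The momentum, in the center-of-momentum frame of the pair `p`, `P - p`, of the particle of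
momentum `p`: the inverse of `cmMap P`. -/
def cmInv (P p : Mom) : Mom := boostInv (√(sVar p (P - p))) P (p - (1 / 2 : ℝ) • P)

lemma two_energy_pos (u : Mom) : 0 < 2 * energy u := mul_pos two_pos (energy_pos u)

lemma energy_congr {u v : Mom} (h : ‖u‖ = ‖v‖) : energy u = energy v := by rw [energy, energy, h]

lemma cmMap_neg (P u : Mom) : cmMap P (-u) = P - cmMap P u := by
  rw [cmMap, cmMap, energy_congr (norm_neg u), map_neg]
  module

lemma cmMap_add_neg (P u : Mom) : cmMap P u + cmMap P (-u) = P := by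
  rw [cmMap_neg, add_sub_cancel]

lemma energy_cmMap (P u : Mom) :
    energy (cmMap P u) = systemEnergy (2 * energy u) P / 2 + ⟪P, u⟫_ℝ / (2 * energy u) := by
  have hR := two_energy_pos u
  have hE := systemEnergy_pos hR P
  have hinner : |⟪P, u⟫_ℝ| ≤ systemEnergy (2 * energy u) P * energy u :=
    (abs_real_inner_le_norm P u).trans
      (mul_le_mul (norm_le_systemEnergy _ P) (norm_le_energy u) (norm_nonneg _) hE.le)
  rw [energy, Real.sqrt_eq_iff_eq_sq (by positivity)]
  · rw [cmMap, norm_add_sq_real, norm_boost_sq hR, real_inner_smul_left, inner_boost hR, norm_smul,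
      mul_pow, norm_sq_eq_systemEnergy_sub_mul_add (2 * energy u) P, Real.norm_eq_abs, sq_abs]
    linear_combination -energy_sq u
  · have := neg_le_of_abs_le hinner
    rw [div_add_div _ _ two_ne_zero hR.ne']
    exact div_nonneg (by linarith) (by positivity)

lemma energy_cmMap_neg (P u : Mom) :
    energy (cmMap P (-u)) = systemEnergy (2 * energy u) P / 2 - ⟪P, u⟫_ℝ / (2 * energy u) := by
  rw [energy_cmMap, energy_congr (norm_neg u), inner_neg_right, neg_div, sub_eq_add_neg]

lemma sVar_cmMap (P u : Mom) : sVar (cmMap P u) (cmMap P (-u)) = (2 * energy u) ^ 2 := by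
  rw [sVar_eq, energy_cmMap, energy_cmMap_neg, cmMap_add_neg, add_add_sub_cancel, add_halves,
    systemEnergy_sq, add_sub_cancel_right]

lemma gVar_cmMap (P u : Mom) : gVar (cmMap P u) (cmMap P (-u)) = 2 * ‖u‖ := by
  rw [gVar_eq, sVar_cmMap, mul_pow, energy_sq, ← Real.sqrt_sq (by positivity : 0 ≤ 2 * ‖u‖)]
  ring_nf

lemma two_energy_cmInv (p q : Mom) : 2 * energy (cmInv (p + q) p) = √(sVar p q) := by
  have hs := sVar_pos p q
  have hinner : ⟪p + q, p - (1 / 2 : ℝ) • (p + q)⟫_ℝ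
      = (energy p + energy q) * ((energy p - energy q) / 2) := by
    simp only [inner_sub_right, inner_smul_right, inner_add_left, inner_add_right,
      real_inner_self_eq_norm_sq, real_inner_comm p q]
    linear_combination (energy_sq q - energy_sq p) / 2
  have hnorm : ‖p - (1 / 2 : ℝ) • (p + q)‖ ^ 2 = ‖p - q‖ ^ 2 / 4 := by
    rw [show p - (1 / 2 : ℝ) • (p + q) = (1 / 2 : ℝ) • (p - q) by module, norm_smul, mul_pow]
    norm_num
    ring
  have hcm : ‖cmInv (p + q) p‖ ^ 2 = (sVar p q - 4) / 4 := by
    rw [cmInv, add_sub_cancel_left, norm_boostInv_sq (Real.sqrt_pos.2 hs), systemEnergy_sqrt_sVar,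
      hinner, hnorm, mul_div_cancel_left₀ _ (add_pos (energy_pos p) (energy_pos q)).ne']
    linear_combination norm_sub_sq_sub_energy_sub_sq p q / 4
  rw [energy, hcm, ← Real.sqrt_sq zero_le_two, ← Real.sqrt_mul (by positivity)]
  ring_nf

lemma cmMap_cmInv (P p : Mom) : cmMap P (cmInv P p) = p := by
  obtain ⟨q, rfl⟩ : ∃ q, P = p + q := ⟨P - p, (add_sub_cancel p P).symm⟩
  rw [cmMap, two_energy_cmInv, cmInv, add_sub_cancel_left,
    boost_boostInv (Real.sqrt_pos.2 (sVar_pos p q)), add_sub_cancel]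

lemma cmInv_cmMap (P u : Mom) : cmInv P (cmMap P u) = u := by
  rw [cmInv, ← cmMap_neg, sVar_cmMap, Real.sqrt_sq (two_energy_pos u).le, cmMap,
    add_sub_cancel_left, boostInv_boost (two_energy_pos u)]

lemma boostedDirection_eq_boost (p q : Mom) (ω : S2) :
    boostedDirection p q ω = boost (√(sVar p q)) (p + q) ω := by
  have hcoeff := boostCoeff_mul_norm_sq (Real.sqrt_pos.2 (sVar_pos p q)) (p + q)
  rw [boost_apply, boostedDirection, lorentzFactor, ← systemEnergy_sqrt_sVar, ← hcoeff]
  rcases eq_or_ne (p + q) 0 with hpq | hpq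
  · rw [hpq, smul_zero, smul_zero]
  · have := norm_ne_zero_iff.2 hpq
    congr 2
    field_simp

lemma two_energy_half_gVar_smul (p q : Mom) (ω : S2) :
    2 * energy ((gVar p q / 2) • (ω : Mom)) = √(sVar p q) := by
  rw [energy, norm_smul, norm_eq_of_mem_sphere, mul_one, Real.norm_eq_abs, sq_abs, div_pow,
    gVar_sq, ← Real.sqrt_sq zero_le_two, ← Real.sqrt_mul (by positivity)]
  ring_nf

lemma postP_eq_cmMap (p q : Mom) (ω : S2) :
    postP p q ω = cmMap (p + q) ((gVar p q / 2) • (ω : Mom)) := by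
  rw [postP, cmMap, two_energy_half_gVar_smul, boostedDirection_eq_boost, map_smul]

lemma postQ_eq_cmMap (p q : Mom) (ω : S2) :
    postQ p q ω = cmMap (p + q) (-((gVar p q / 2) • (ω : Mom))) := by
  rw [cmMap_neg, ← postP_eq_cmMap, postP, postQ]
  module

lemma energy_postP (p q : Mom) (ω : S2) : energy (postP p q ω)
    = (energy p + energy q) / 2 + ⟪(gVar p q / (2 * √(sVar p q))) • (p + q), (ω : Mom)⟫_ℝ := by
  rw [postP_eq_cmMap, energy_cmMap, two_energy_half_gVar_smul, systemEnergy_sqrt_sVar,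
    real_inner_smul_left, real_inner_smul_right]
  ring

lemma gVar_postP_postQ (p q : Mom) (ω : S2) : gVar (postP p q ω) (postQ p q ω) = gVar p q := by
  rw [postP_eq_cmMap, postQ_eq_cmMap, gVar_cmMap, norm_smul, norm_eq_of_mem_sphere, mul_one,
    Real.norm_of_nonneg (div_nonneg (gVar_nonneg p q) zero_le_two),
    mul_div_cancel₀ _ two_ne_zero]

lemma postP_cmMap (P u : Mom) (ω : S2) :
    postP (cmMap P u) (cmMap P (-u)) ω = cmMap P (‖u‖ • (ω : Mom)) := by
  rw [postP_eq_cmMap, cmMap_add_neg, gVar_cmMap, mul_div_cancel_left₀ _ two_ne_zero]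

lemma postQ_cmMap (P u : Mom) (ω : S2) :
    postQ (cmMap P u) (cmMap P (-u)) ω = cmMap P (-(‖u‖ • (ω : Mom))) := by
  rw [postQ_eq_cmMap, cmMap_add_neg, gVar_cmMap, mul_div_cancel_left₀ _ two_ne_zero]

end Kinematics

section ChangeOfVariables

lemma hasFDerivAt_energy (u : Mom) : HasFDerivAt energy ((energy u)⁻¹ • innerSL ℝ u) u := by
  refine (((hasStrictFDerivAt_norm_sq u).hasFDerivAt.const_add 1).sqrt
    (by positivity)).congr_fderiv ?_
  rw [← energy, two_smul ℕ, ← two_smul ℝ, smul_smul]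
  congr 1
  field_simp

/-- The linear form for which `LinearMap.transvection (cmDerivForm P u) P` is the derivative of
`cmMap P` at `u`. -/
def cmDerivForm (P u : Mom) : Mom →L[ℝ] ℝ :=
  boostCoeff (2 * energy u) P • innerSL ℝ P + ⟪P, u⟫_ℝ •
    (-1 / ((2 * energy u) ^ 2 * systemEnergy (2 * energy u) P)) • (2 : ℝ) •
      (energy u)⁻¹ • innerSL ℝ u

lemma hasFDerivAt_cmMap (P u : Mom) : HasFDerivAt (cmMap P)
    (ContinuousLinearMap.id ℝ Mom + (cmDerivForm P u).smulRight P) u := by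
  have hcoeff := (hasDerivAt_boostCoeff (two_energy_pos u) P).comp_hasFDerivAt u
    ((hasFDerivAt_energy u).const_mul 2)
  exact ((hasFDerivAt_id u).add ((hcoeff.mul (innerSL ℝ P).hasFDerivAt).smul_const P)).const_add _

lemma det_fderiv_cmMap (P u : Mom) :
    (ContinuousLinearMap.id ℝ Mom + (cmDerivForm P u).smulRight P).det
      = 4 * (energy (cmMap P u) * energy (cmMap P (-u)))
        / (2 * energy u * systemEnergy (2 * energy u) P) := by
  have htransvection : ((ContinuousLinearMap.id ℝ Mom + (cmDerivForm P u).smulRight P :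
      Mom →L[ℝ] Mom) : Mom →ₗ[ℝ] Mom) = LinearMap.transvection (cmDerivForm P u : Mom →ₗ[ℝ] ℝ) P :=
    rfl
  have hR := energy_pos u
  have hE := systemEnergy_pos (two_energy_pos u) P
  rw [ContinuousLinearMap.det, htransvection, LinearMap.transvection.det, energy_cmMap,
    energy_cmMap_neg, ContinuousLinearMap.coe_coe, cmDerivForm]
  simp only [add_apply, smul_apply, innerSL_apply_apply, smul_eq_mul, real_inner_self_eq_norm_sq,
    boostCoeff_mul_norm_sq (two_energy_pos u), real_inner_comm P u]
  field_simp
  ring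

@[fun_prop]
lemma continuous_energy : Continuous energy := by unfold energy; fun_prop

@[fun_prop]
lemma continuous_sVar : Continuous fun z : Mom × Mom => sVar z.1 z.2 := by
  simp only [sVar_eq]; fun_prop

@[fun_prop]
lemma continuous_gVar : Continuous fun z : Mom × Mom => gVar z.1 z.2 := by
  simp only [gVar_eq]; fun_prop

@[fun_prop]
lemma continuous_mollerVelocity : Continuous fun z : Mom × Mom => mollerVelocity z.1 z.2 := by
  unfold mollerVelocity
  exact (continuous_gVar.mul continuous_sVar.sqrt).div (by fun_prop)
    fun z => (mul_pos (energy_pos z.1) (energy_pos z.2)).ne'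

@[fun_prop]
lemma continuous_cmMap : Continuous fun z : Mom × Mom => cmMap z.1 z.2 := by
  have henergy : Continuous fun z : Mom × Mom => systemEnergy (2 * energy z.2) z.1 := by
    unfold systemEnergy; fun_prop
  have hcoeff : Continuous fun z : Mom × Mom => boostCoeff (2 * energy z.2) z.1 := by
    refine continuous_const.div (by fun_prop) fun z => ?_
    have := energy_pos z.2
    have := systemEnergy_nonneg (2 * energy z.2) z.1
    positivity
  simp only [cmMap, boost_apply]
  fun_prop

@[fun_prop]
lemma continuous_postP : Continuous fun z : (Mom × Mom) × S2 => postP z.1.1 z.1.2 z.2 := by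
  simp only [postP_eq_cmMap]
  fun_prop

@[fun_prop]
lemma continuous_postQ : Continuous fun z : (Mom × Mom) × S2 => postQ z.1.1 z.1.2 z.2 := by
  simp only [postQ_eq_cmMap]
  fun_prop

lemma lintegral_eq_lintegral_cmMap (P : Mom) (G : Mom → ℝ≥0∞) :
    ∫⁻ p, G p = ∫⁻ u, ENNReal.ofReal (4 * (energy (cmMap P u) * energy (cmMap P (-u)))
      / (2 * energy u * systemEnergy (2 * energy u) P)) * G (cmMap P u) := by
  have hrange : Set.range (cmMap P) = Set.univ :=
    (Function.RightInverse.surjective (cmMap_cmInv P)).range_eq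
  have hchange := lintegral_image_eq_lintegral_abs_det_fderiv_mul volume
    (MeasurableSet.univ (α := Mom)) (fun u _ => (hasFDerivAt_cmMap P u).hasFDerivWithinAt)
    (Function.LeftInverse.injective (cmInv_cmMap P)).injOn G
  rw [Set.image_univ, hrange, Measure.restrict_univ] at hchange
  rw [hchange]
  refine lintegral_congr fun u => ?_
  have := energy_pos u
  have := systemEnergy_pos (two_energy_pos u) P
  have := energy_pos (cmMap P u)
  have := energy_pos (cmMap P (-u))
  rw [det_fderiv_cmMap, abs_of_pos (by positivity)]

theorem lintegral_lintegral_eq_cmMap {G : Mom → Mom → ℝ≥0∞}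
    (hG : Measurable (Function.uncurry G)) :
    ∫⁻ p, ∫⁻ q, G p q = ∫⁻ P, ∫⁻ u, ENNReal.ofReal
      (4 * (energy (cmMap P u) * energy (cmMap P (-u)))
        / (2 * energy u * systemEnergy (2 * energy u) P)) * G (cmMap P u) (cmMap P (-u)) :=
  calc ∫⁻ p, ∫⁻ q, G p q = ∫⁻ p, ∫⁻ P, G p (P - p) :=
        lintegral_congr fun p => (lintegral_sub_right_eq_self (G p) p).symm
    _ = ∫⁻ P, ∫⁻ p, G p (P - p) := lintegral_lintegral_swap
        (hG.comp (measurable_fst.prodMk (measurable_snd.sub measurable_fst))).aemeasurable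
    _ = _ := by
        refine lintegral_congr fun P => ?_
        rw [lintegral_eq_lintegral_cmMap P]
        simp only [cmMap_neg]

lemma jacobian_mul_mollerVelocity (P u : Mom) :
    4 * (energy (cmMap P u) * energy (cmMap P (-u)))
        / (2 * energy u * systemEnergy (2 * energy u) P)
      * mollerVelocity (cmMap P u) (cmMap P (-u)) = 8 * ‖u‖ / systemEnergy (2 * energy u) P := by
  have := energy_pos u
  have := systemEnergy_pos (two_energy_pos u) P
  have := energy_pos (cmMap P u)
  have := energy_pos (cmMap P (-u))
  rw [mollerVelocity, gVar_cmMap, sVar_cmMap, Real.sqrt_sq (two_energy_pos u).le]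
  field_simp
  ring

instance : IsFiniteMeasure sphereMeasure :=
  inferInstanceAs (IsFiniteMeasure (volume : Measure Mom).toSphere)

lemma lintegral_collision_eq_cmMap {Φ : Mom × Mom → Mom × Mom → ℝ≥0∞}
    (hΦ : Measurable (Function.uncurry Φ)) :
    ∫⁻ p, ∫⁻ q, ENNReal.ofReal (mollerVelocity p q) *
        ∫⁻ ω, Φ (p, q) (postP p q ω, postQ p q ω) ∂sphereMeasure
      = ∫⁻ P, ∫⁻ u, ∫⁻ ω : S2, ENNReal.ofReal (8 * ‖u‖ / systemEnergy (2 * energy u) P) *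
          Φ (cmMap P u, cmMap P (-u)) (cmMap P (‖u‖ • (ω : Mom)), cmMap P (-(‖u‖ • (ω : Mom))))
          ∂sphereMeasure := by
  have hgain : Measurable fun z : Mom × Mom =>
      ∫⁻ ω, Φ z (postP z.1 z.2 ω, postQ z.1 z.2 ω) ∂sphereMeasure :=
    Measurable.lintegral_prod_right' (f := fun z : (Mom × Mom) × S2 =>
      Φ z.1 (postP z.1.1 z.1.2 z.2, postQ z.1.1 z.1.2 z.2))
      (hΦ.comp (f := fun z : (Mom × Mom) × S2 =>
        (z.1, postP z.1.1 z.1.2 z.2, postQ z.1.1 z.1.2 z.2)) (by fun_prop))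
  rw [lintegral_lintegral_eq_cmMap
    (G := fun p q => ENNReal.ofReal (mollerVelocity p q) *
      ∫⁻ ω, Φ (p, q) (postP p q ω, postQ p q ω) ∂sphereMeasure)
    (continuous_mollerVelocity.measurable.ennreal_ofReal.mul hgain)]
  refine lintegral_congr fun P => lintegral_congr fun u => ?_
  have := energy_pos (cmMap P u)
  have := energy_pos (cmMap P (-u))
  have := energy_pos u
  have := systemEnergy_nonneg (2 * energy u) P
  rw [← mul_assoc, ← ENNReal.ofReal_mul (by positivity), jacobian_mul_mollerVelocity,
    lintegral_const_mul' _ _ ENNReal.ofReal_ne_top]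
  simp only [postP_cmMap, postQ_cmMap]

theorem lintegral_collision_comm {Φ : Mom × Mom → Mom × Mom → ℝ≥0∞}
    (hΦ : Measurable (Function.uncurry Φ)) :
    ∫⁻ p, ∫⁻ q, ENNReal.ofReal (mollerVelocity p q) *
        ∫⁻ ω, Φ (p, q) (postP p q ω, postQ p q ω) ∂sphereMeasure
      = ∫⁻ p, ∫⁻ q, ENNReal.ofReal (mollerVelocity p q) *
        ∫⁻ ω, Φ (postP p q ω, postQ p q ω) (p, q) ∂sphereMeasure := by
  rw [lintegral_collision_eq_cmMap hΦ,
    lintegral_collision_eq_cmMap (Φ := fun z z' => Φ z' z) (hΦ.comp measurable_swap)]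
  refine lintegral_congr fun P => ?_
  have hnorm (u : Mom) (ω : S2) : ‖‖u‖ • (ω : Mom)‖ = ‖u‖ := by
    rw [norm_smul, norm_norm, norm_eq_of_mem_sphere, mul_one]
  have hswap := lintegral_toSphere_norm_smul_comm (volume : Measure Mom) (X := fun u v =>
    ENNReal.ofReal (8 * ‖u‖ / systemEnergy (2 * energy u) P) *
      Φ (cmMap P u, cmMap P (-u)) (cmMap P v, cmMap P (-v))) <| by
    have : Continuous fun z : Mom × Mom => systemEnergy (2 * energy z.1) P := by
      unfold systemEnergy; fun_prop
    have : Measurable fun z : Mom × Mom =>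
        Φ (cmMap P z.1, cmMap P (-z.1)) (cmMap P z.2, cmMap P (-z.2)) :=
      hΦ.comp (f := fun z : Mom × Mom =>
        ((cmMap P z.1, cmMap P (-z.1)), (cmMap P z.2, cmMap P (-z.2)))) (by fun_prop)
    unfold Function.uncurry
    fun_prop
  simpa only [sphereMeasure, hnorm, energy_congr (hnorm _ _)] using hswap

end ChangeOfVariables

section HardSphereGain

/-- The gain term, at a fixed point in space, for the scattering kernel `σ(g, θ) = g`. -/
def hardSphereGain (F H : Mom → ℝ≥0∞) (p : Mom) : ℝ≥0∞ :=
  ∫⁻ q, ENNReal.ofReal (mollerVelocity p q) *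
    ∫⁻ ω, ENNReal.ofReal (gVar p q) * (F (postP p q ω) * H (postQ p q ω)) ∂sphereMeasure

/-- The rate at which colliding particles of momenta `p` and `q` produce the quantity `φ`. -/
def collisionRate (φ : Mom → ℝ≥0∞) (p q : Mom) : ℝ≥0∞ :=
  ENNReal.ofReal (mollerVelocity p q * gVar p q) * ∫⁻ ω, φ (postP p q ω) ∂sphereMeasure

lemma mul_hardSphereGain {F H : Mom → ℝ≥0∞} (hF : Measurable F) (hH : Measurable H) (c : ℝ≥0∞)
    (p : Mom) :
    c * hardSphereGain F H p = ∫⁻ q, ENNReal.ofReal (mollerVelocity p q) *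
      ∫⁻ ω, ENNReal.ofReal (gVar p q) * c * (F (postP p q ω) * H (postQ p q ω)) ∂sphereMeasure := by
  have hgain : Measurable fun z : (Mom × Mom) × S2 => ENNReal.ofReal (gVar z.1.1 z.1.2) *
      (F (postP z.1.1 z.1.2 z.2) * H (postQ z.1.1 z.1.2 z.2)) :=
    (continuous_gVar.measurable.comp measurable_fst).ennreal_ofReal.mul
      ((hF.comp continuous_postP.measurable).mul (hH.comp continuous_postQ.measurable))
  have hgain_q : Measurable fun q => ∫⁻ ω, ENNReal.ofReal (gVar p q) *
      (F (postP p q ω) * H (postQ p q ω)) ∂sphereMeasure :=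
    hgain.lintegral_prod_right'.comp (f := fun q => (p, q)) (by fun_prop)
  rw [hardSphereGain, ← lintegral_const_mul _ (by fun_prop)]
  refine lintegral_congr fun q => ?_
  have hgain_ω : Measurable fun ω => ENNReal.ofReal (gVar p q) *
      (F (postP p q ω) * H (postQ p q ω)) :=
    hgain.comp (f := fun ω => ((p, q), ω)) (by fun_prop)
  rw [mul_left_comm, ← lintegral_const_mul _ hgain_ω]
  simp only [mul_left_comm c, mul_assoc]

lemma lintegral_mul_hardSphereGain {φ F H : Mom → ℝ≥0∞} (hφ : Measurable φ) (hF : Measurable F)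
    (hH : Measurable H) :
    ∫⁻ p, φ p * hardSphereGain F H p
      = ∫⁻ p, ∫⁻ q, collisionRate φ p q * (F p * H q) :=
  calc ∫⁻ p, φ p * hardSphereGain F H p
      = ∫⁻ p, ∫⁻ q, ENNReal.ofReal (mollerVelocity p q) * ∫⁻ ω, ENNReal.ofReal (gVar p q) *
          φ p * (F (postP p q ω) * H (postQ p q ω)) ∂sphereMeasure := by
        simp only [mul_hardSphereGain hF hH]
    _ = ∫⁻ p, ∫⁻ q, ENNReal.ofReal (mollerVelocity p q) * ∫⁻ ω,
          ENNReal.ofReal (gVar (postP p q ω) (postQ p q ω)) * φ (postP p q ω) *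
            (F p * H q) ∂sphereMeasure :=
        lintegral_collision_comm (Φ := fun z z' => ENNReal.ofReal (gVar z.1 z.2) * φ z.1 *
          (F z'.1 * H z'.2)) (by unfold Function.uncurry; fun_prop)
    _ = _ := by
        refine lintegral_congr fun p => lintegral_congr fun q => ?_
        have hω : Measurable fun ω : S2 => φ (postP p q ω) :=
          hφ.comp (continuous_postP.measurable.comp (f := fun ω : S2 => ((p, q), ω)) (by fun_prop))
        simp only [gVar_postP_postQ]
        rw [lintegral_mul_const _ (hω.const_mul _), lintegral_const_mul _ hω, collisionRate,
          ENNReal.ofReal_mul (mollerVelocity_nonneg p q)]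
        ring

lemma gVar_le_sqrt_sVar (p q : Mom) : gVar p q ≤ √(sVar p q) := by
  rw [gVar_eq]
  exact Real.sqrt_le_sqrt (by linarith)

lemma norm_gVar_smul_add_le (p q : Mom) :
    ‖(gVar p q / (2 * √(sVar p q))) • (p + q)‖ ≤ (energy p + energy q) / 2 := by
  have hs : 0 < √(sVar p q) := Real.sqrt_pos.2 (sVar_pos p q)
  have hg := gVar_nonneg p q
  have hcoeff : gVar p q / (2 * √(sVar p q)) ≤ 1 / 2 := by
    rw [div_le_div_iff₀ (by positivity) two_pos]
    linarith [gVar_le_sqrt_sVar p q]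
  have hP : ‖p + q‖ ≤ energy p + energy q :=
    (norm_add_le p q).trans (add_le_add (norm_le_energy p) (norm_le_energy q))
  calc ‖(gVar p q / (2 * √(sVar p q))) • (p + q)‖
      = gVar p q / (2 * √(sVar p q)) * ‖p + q‖ := by
        rw [norm_smul, Real.norm_of_nonneg (by positivity)]
    _ ≤ 1 / 2 * (energy p + energy q) := by gcongr
    _ = (energy p + energy q) / 2 := by ring

lemma mollerVelocity_mul_gVar_le (p q : Mom) : mollerVelocity p q * gVar p q
    ≤ 16 * (√(energy p) * √(energy q)) * (gVar p q / (2 * √(sVar p q))) := by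
  set r := √(sVar p q)
  set t := √(energy p) * √(energy q)
  have hr : 0 < r := Real.sqrt_pos.2 (sVar_pos p q)
  have ht : 0 < t := mul_pos (Real.sqrt_pos.2 (energy_pos p)) (Real.sqrt_pos.2 (energy_pos q))
  have ht2 : energy p * energy q = t ^ 2 := by
    rw [mul_pow, Real.sq_sqrt (energy_pos p).le, Real.sq_sqrt (energy_pos q).le]
  have hg := gVar_nonneg p q
  have hgr : gVar p q ≤ r := gVar_le_sqrt_sVar p q
  have hrt : r ≤ 2 * t := Real.sqrt_le_iff.2 ⟨by positivity, by
    rw [mul_pow, ← ht2]; linarith [sVar_le p q]⟩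
  rw [mollerVelocity, ht2]
  calc gVar p q * r / t ^ 2 * gVar p q
      = gVar p q * r ^ 2 * (2 / t ^ 2) * (gVar p q / (2 * r)) := by field_simp
    _ ≤ (2 * t) * (2 * t) ^ 2 * (2 / t ^ 2) * (gVar p q / (2 * r)) := by
        gcongr
        exact hgr.trans hrt
    _ = 16 * t * (gVar p q / (2 * r)) := by field_simp; ring

lemma expWeight_mul_expWeight (k : ℝ) (p q : Mom) :
    expWeight k p * expWeight k q = Real.exp (k * (energy p + energy q)) := by
  rw [expWeight, expWeight, ← Real.exp_add, mul_add]

@[fun_prop]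
lemma continuous_expWeight (k : ℝ) : Continuous (expWeight k) := by unfold expWeight; fun_prop

lemma expWeight_pos (k : ℝ) (p : Mom) : 0 < expWeight k p := Real.exp_pos _

lemma expWeight_postP (k : ℝ) (p q : Mom) (ω : S2) : expWeight k (postP p q ω)
    = Real.exp (k * (energy p + energy q) / 2) *
      Real.exp ⟪(k * (gVar p q / (2 * √(sVar p q)))) • (p + q), (ω : Mom)⟫_ℝ := by
  rw [expWeight, energy_postP, ← Real.exp_add, mul_smul, real_inner_smul_left _ _ k]
  ring_nf

lemma exists_lintegral_expWeight_postP_le : ∃ C : ℝ, 0 < C ∧ ∀ k, 0 < k →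
    ∀ p q : Mom, p + q ≠ 0 → 0 < gVar p q →
      ∫⁻ ω, ENNReal.ofReal (expWeight k (postP p q ω)) ∂sphereMeasure
        ≤ ENNReal.ofReal (C * (expWeight k p * expWeight k q) /
          (k * (gVar p q / (2 * √(sVar p q))) * ‖p + q‖)) := by
  obtain ⟨C, hC, hexp⟩ := exists_lintegral_toSphere_exp_inner_le Mom
  refine ⟨C, hC, fun k hk p q hpq hg => ?_⟩
  set c := gVar p q / (2 * √(sVar p q)) with hc_def
  have hc : 0 < c := div_pos hg (mul_pos two_pos (Real.sqrt_pos.2 (sVar_pos p q)))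
  set v := (k * c) • (p + q) with hv_def
  have hv : v ≠ 0 := smul_ne_zero (mul_pos hk hc).ne' hpq
  have hnorm : ‖v‖ = k * c * ‖p + q‖ := by
    rw [norm_smul, Real.norm_of_nonneg (mul_pos hk hc).le]
  have hnorm_le : ‖v‖ ≤ k * ((energy p + energy q) / 2) := by
    rw [hv_def, mul_smul, norm_smul, Real.norm_of_nonneg hk.le]
    gcongr
    exact norm_gVar_smul_add_le p q
  have hvnorm : √‖v‖ ^ (Module.finrank ℝ Mom - 1) = ‖v‖ := by
    rw [finrank_euclideanSpace_fin, Real.sq_sqrt (norm_nonneg v)]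
  calc ∫⁻ ω, ENNReal.ofReal (expWeight k (postP p q ω)) ∂sphereMeasure
      = ENNReal.ofReal (Real.exp (k * (energy p + energy q) / 2)) *
          ∫⁻ ω : S2, ENNReal.ofReal (Real.exp ⟪v, (ω : Mom)⟫_ℝ) ∂sphereMeasure := by
        rw [← lintegral_const_mul' _ _ ENNReal.ofReal_ne_top]
        simp only [expWeight_postP, ENNReal.ofReal_mul (Real.exp_pos _).le, ← hc_def]
        rfl
    _ ≤ ENNReal.ofReal (Real.exp (k * (energy p + energy q) / 2)) *
          ENNReal.ofReal (C * (Real.exp ‖v‖ / ‖v‖)) := by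
        gcongr
        exact (hexp v hv).trans_eq (by rw [hvnorm])
    _ ≤ _ := by
        rw [← ENNReal.ofReal_mul (Real.exp_pos _).le, expWeight_mul_expWeight, ← hnorm]
        refine ENNReal.ofReal_le_ofReal ?_
        calc _ = C * (Real.exp (k * (energy p + energy q) / 2) * Real.exp ‖v‖) / ‖v‖ := by ring
          _ ≤ C * Real.exp (k * (energy p + energy q)) / ‖v‖ := by
            rw [← Real.exp_add]
            gcongr
            linarith

theorem exists_collisionRate_expWeight_le : ∃ C : ℝ, 0 < C ∧ ∀ k, 0 < k → ∀ p q : Mom, p + q ≠ 0 →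
    collisionRate (fun p => ENNReal.ofReal (expWeight k p)) p q
      ≤ ENNReal.ofReal (C * k⁻¹) * ENNReal.ofReal
        (√(energy p) * expWeight k p * (√(energy q) * expWeight k q) / ‖p + q‖) := by
  obtain ⟨C, hC, hint⟩ := exists_lintegral_expWeight_postP_le
  refine ⟨16 * C, by positivity, fun k hk p q hpq => ?_⟩
  rcases (gVar_nonneg p q).eq_or_lt' with hg | hg
  · simp [collisionRate, hg]
  have hrate := mollerVelocity_mul_gVar_le p q
  have hpost := hint k hk p q hpq hg
  have : 0 < ‖p + q‖ := norm_pos_iff.2 hpq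
  have hs : 0 < √(sVar p q) := Real.sqrt_pos.2 (sVar_pos p q)
  have hp := expWeight_pos k p
  have hq := expWeight_pos k q
  calc _ ≤ ENNReal.ofReal
          (16 * (√(energy p) * √(energy q)) * (gVar p q / (2 * √(sVar p q)))) *
        ENNReal.ofReal (C * (expWeight k p * expWeight k q) /
          (k * (gVar p q / (2 * √(sVar p q))) * ‖p + q‖)) := by
        unfold collisionRate
        gcongr
    _ = _ := by
        rw [← ENNReal.ofReal_mul (by positivity), ← ENNReal.ofReal_mul (by positivity)]
        congr 1
        field_simp

end HardSphereGain

section EssentialSupremum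

variable {α β ε : Type*} [MeasurableSpace α] [MeasurableSpace β] [ENorm ε] {μ : Measure α}
  {f : α → β → ε}

lemma measurable_eLpNormEssSup [SFinite μ] (hf : Measurable fun z : α × β => ‖f z.1 z.2‖ₑ) :
    Measurable fun y => eLpNormEssSup (fun x => f x y) μ := by
  refine measurable_of_Iic fun a => ?_
  have hsublevel : (fun y => eLpNormEssSup (fun x => f x y) μ) ⁻¹' Set.Iic a
      = {y | μ {x | ¬ ‖f x y‖ₑ ≤ a} = 0} := Set.ext fun y =>
    ⟨fun h => ae_le_eLpNormEssSup.mono fun x hx => hx.trans h, eLpNormEssSup_le_of_ae_enorm_bound⟩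
  rw [hsublevel]
  exact measurable_measure_prodMk_right (measurableSet_le hf measurable_const).compl
    (measurableSet_singleton 0)

lemma ae_ae_enorm_le_eLpNormEssSup [SFinite μ] {ν : Measure β} [SFinite ν]
    (hf : Measurable fun z : α × β => ‖f z.1 z.2‖ₑ) :
    ∀ᵐ x ∂μ, ∀ᵐ y ∂ν, ‖f x y‖ₑ ≤ eLpNormEssSup (fun x => f x y) μ :=
  (Measure.ae_ae_comm (p := fun x y => ‖f x y‖ₑ ≤ eLpNormEssSup (fun x => f x y) μ)
    (measurableSet_le hf ((measurable_eLpNormEssSup hf).comp measurable_snd))).2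
    (Filter.Eventually.of_forall fun _ => ae_le_eLpNormEssSup)

end EssentialSupremum

section SupNorm

lemma supNorm_eq {ε : Type*} [ENorm ε] (f : unitInterval → Mom → ε) (p : Mom) :
    supNorm f p = eLpNormEssSup (fun x => f x p) volume := eLpNorm_exponent_top

lemma measurable_supNorm {f : unitInterval → Mom → ℝ} (hf : Measurable (Function.uncurry f)) :
    Measurable (supNorm f) := by
  simpa only [← supNorm_eq] using measurable_eLpNormEssSup (μ := volume) (f := f) hf.enorm

lemma ae_ae_ofReal_comp_le_supNorm {Y : Type*} [MeasurableSpace Y] {ν : Measure Y} [SFinite ν]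
    {f : unitInterval → Mom → ℝ} (hf : Measurable (Function.uncurry f)) (hf0 : ∀ x p, 0 ≤ f x p)
    {T : Y → Mom} (hT : Measurable T) :
    ∀ᵐ x, ∀ᵐ y ∂ν, ENNReal.ofReal (f x (T y)) ≤ supNorm f (T y) := by
  have hfT : Measurable fun z : unitInterval × Y => f z.1 (T z.2) :=
    hf.comp (measurable_fst.prodMk (hT.comp measurable_snd))
  simpa only [Real.enorm_of_nonneg (hf0 _ _), supNorm_eq] using
    ae_ae_enorm_le_eLpNormEssSup (μ := volume) (ν := ν) (f := fun x y => f x (T y)) hfT.enorm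

variable {σ : ℝ → ℝ → ℝ} {B : ℝ}
  (hσ : ∀ g, 0 ≤ g → ∀ θ ∈ Set.Icc 0 Real.pi, σ g θ ≤ B * g)
include hσ

lemma ofReal_mollerVelocity_mul_kernel_le (p q : Mom) (ω : S2) {a b : ℝ} (ha : 0 ≤ a)
    (hb : 0 ≤ b) :
    ENNReal.ofReal (mollerVelocity p q * σ (gVar p q) (scatteringAngle p q ω) * (a * b))
      ≤ ENNReal.ofReal B * ENNReal.ofReal (mollerVelocity p q) *
        (ENNReal.ofReal (gVar p q) * (ENNReal.ofReal a * ENNReal.ofReal b)) := by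
  have hv := mollerVelocity_nonneg p q
  have hg := gVar_nonneg p q
  have hσ' := hσ _ hg (scatteringAngle p q ω) ⟨Real.arccos_nonneg _, Real.arccos_le_pi _⟩
  rw [← ENNReal.ofReal_mul ha, ← ENNReal.ofReal_mul hg, ← ENNReal.ofReal_mul' hv,
    ← ENNReal.ofReal_mul' (by positivity)]
  refine ENNReal.ofReal_le_ofReal ?_
  calc mollerVelocity p q * σ (gVar p q) (scatteringAngle p q ω) * (a * b)
      ≤ mollerVelocity p q * (B * gVar p q) * (a * b) := by gcongr
    _ = B * mollerVelocity p q * (gVar p q * (a * b)) := by ring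

lemma supNorm_gain_le {f h : unitInterval → Mom → ℝ}
    (hf : Measurable (Function.uncurry f)) (hh : Measurable (Function.uncurry h))
    (hf0 : ∀ x p, 0 ≤ f x p) (hh0 : ∀ x p, 0 ≤ h x p) (p : Mom) :
    supNorm (gain σ f h) p
      ≤ ENNReal.ofReal B * hardSphereGain (supNorm f) (supNorm h) p := by
  have hf_le := ae_ae_ofReal_comp_le_supNorm (ν := volume.prod sphereMeasure) hf hf0
    (continuous_postP.measurable.comp (f := fun y : Mom × S2 => ((p, y.1), y.2)) (by fun_prop))
  have hh_le := ae_ae_ofReal_comp_le_supNorm (ν := volume.prod sphereMeasure) hh hh0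
    (continuous_postQ.measurable.comp (f := fun y : Mom × S2 => ((p, y.1), y.2)) (by fun_prop))
  rw [supNorm_eq]
  refine eLpNormEssSup_le_of_ae_enorm_bound ?_
  filter_upwards [hf_le, hh_le] with x hfx hhx
  rw [enorm_eq_self, gain, hardSphereGain, ← lintegral_const_mul' _ _ ENNReal.ofReal_ne_top]
  refine lintegral_mono_ae ?_
  filter_upwards [Measure.ae_ae_of_ae_prod hfx, Measure.ae_ae_of_ae_prod hhx] with q hfq hhq
  rw [← mul_assoc, ← lintegral_const_mul' _ _ (by finiteness)]
  refine lintegral_mono_ae ?_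
  filter_upwards [hfq, hhq] with ω hfω hhω
  refine (ofReal_mollerVelocity_mul_kernel_le hσ p q ω (hf0 _ _) (hh0 _ _)).trans ?_
  gcongr
  exacts [hfω, hhω]

end SupNorm

section RieszForm

/-- The bilinear form `∬ W(p) W(q) |p + q|⁻¹ F(p) H(q) dp dq`, through which the gain term is
controlled; at the single momentum `q = -p` the division by zero makes the kernel vanish. -/
def rieszForm (W : Mom → ℝ) (F H : Mom → ℝ≥0∞) : ℝ≥0∞ :=
  ∫⁻ p, ∫⁻ q, ENNReal.ofReal (W p * W q / ‖p + q‖) * (F p * H q)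

variable {W : Mom → ℝ} {F H : Mom → ℝ≥0∞} (hW : Measurable W) (hF : Measurable F)
  (hH : Measurable H)
include hW hF hH

lemma rieszForm_comm : rieszForm W F H = rieszForm W H F := by
  rw [rieszForm, lintegral_lintegral_swap (by unfold Function.uncurry; fun_prop)]
  refine lintegral_congr fun q => lintegral_congr fun p => ?_
  rw [mul_comm (W p), mul_comm (F p), add_comm p]

lemma rieszForm_le (hW0 : ∀ p, 0 ≤ W p) : rieszForm W F H
    ≤ (⨆ a, ∫⁻ q, ENNReal.ofReal (W q / ‖q - a‖) * H q) * ∫⁻ p, ENNReal.ofReal (W p) * F p := by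
  rw [rieszForm, ← lintegral_const_mul _ (by fun_prop)]
  refine lintegral_mono fun p => ?_
  calc ∫⁻ q, ENNReal.ofReal (W p * W q / ‖p + q‖) * (F p * H q)
      = ∫⁻ q, ENNReal.ofReal (W q / ‖q - -p‖) * H q * (ENNReal.ofReal (W p) * F p) := by
        refine lintegral_congr fun q => ?_
        rw [sub_neg_eq_add, add_comm q, mul_div_assoc, ENNReal.ofReal_mul (hW0 p)]
        ring
    _ = (∫⁻ q, ENNReal.ofReal (W q / ‖q - -p‖) * H q) * (ENNReal.ofReal (W p) * F p) :=
        lintegral_mul_const _ (by fun_prop)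
    _ ≤ _ := by
        gcongr
        exact le_iSup (fun a => ∫⁻ q, ENNReal.ofReal (W q / ‖q - a‖) * H q) (-p)

end RieszForm

section GainEstimate

theorem exists_lintegral_expWeight_mul_hardSphereGain_le : ∃ C : ℝ, 0 < C ∧ ∀ k, 0 < k →
    ∀ F H : Mom → ℝ≥0∞, Measurable F → Measurable H →
      ∫⁻ p, ENNReal.ofReal (expWeight k p) * hardSphereGain F H p
        ≤ ENNReal.ofReal (C * k⁻¹) * rieszForm (fun p => √(energy p) * expWeight k p) F H := by
  obtain ⟨C, hC, hrate⟩ := exists_collisionRate_expWeight_le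
  refine ⟨C, hC, fun k hk F H hF hH => ?_⟩
  rw [lintegral_mul_hardSphereGain (by fun_prop) hF hH, rieszForm,
    ← lintegral_const_mul' _ _ ENNReal.ofReal_ne_top]
  refine lintegral_mono fun p => ?_
  rw [← lintegral_const_mul' _ _ ENNReal.ofReal_ne_top]
  refine lintegral_mono_ae ?_
  filter_upwards [compl_mem_ae_iff.2 (measure_singleton (-p))] with q hq
  have hpq : p + q ≠ 0 := fun h => hq (eq_neg_of_add_eq_zero_right h)
  exact (mul_le_mul_left (hrate k hk p q hpq) _).trans_eq (mul_assoc _ _ _)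

theorem exists_lintegral_expWeight_mul_supNorm_gain_le : ∃ C : ℝ, 0 < C ∧
    ∀ (σ : ℝ → ℝ → ℝ) (B : ℝ), (∀ g, 0 ≤ g → ∀ θ ∈ Set.Icc 0 Real.pi, σ g θ ≤ B * g) →
    ∀ k : ℝ, 0 < k → ∀ f h : unitInterval → Mom → ℝ,
      Measurable (Function.uncurry f) → Measurable (Function.uncurry h) →
      (∀ x p, 0 ≤ f x p) → (∀ x p, 0 ≤ h x p) →
      ∫⁻ p, ENNReal.ofReal (expWeight k p) * supNorm (gain σ f h) p
        ≤ ENNReal.ofReal (C * B * k⁻¹) *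
          rieszForm (fun p => √(energy p) * expWeight k p) (supNorm f) (supNorm h) := by
  obtain ⟨C, hC, hgain⟩ := exists_lintegral_expWeight_mul_hardSphereGain_le
  refine ⟨C, hC, fun σ B hσ k hk f h hf hh hf0 hh0 => ?_⟩
  calc ∫⁻ p, ENNReal.ofReal (expWeight k p) * supNorm (gain σ f h) p
      ≤ ∫⁻ p, ENNReal.ofReal B * (ENNReal.ofReal (expWeight k p) *
          hardSphereGain (supNorm f) (supNorm h) p) := by
        refine lintegral_mono fun p => ?_
        rw [mul_left_comm]
        gcongr
        exact supNorm_gain_le hσ hf hh hf0 hh0 p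
    _ = ENNReal.ofReal B * ∫⁻ p, ENNReal.ofReal (expWeight k p) *
          hardSphereGain (supNorm f) (supNorm h) p :=
        lintegral_const_mul' _ _ ENNReal.ofReal_ne_top
    _ ≤ ENNReal.ofReal B * (ENNReal.ofReal (C * k⁻¹) *
          rieszForm (fun p => √(energy p) * expWeight k p) (supNorm f) (supNorm h)) := by
        gcongr
        exact hgain k hk _ _ (measurable_supNorm hf) (measurable_supNorm hh)
    _ = _ := by
        rw [← mul_assoc, ← ENNReal.ofReal_mul' (by positivity)]
        ring_nf

lemma rieszForm_supNorm_le (k : ℝ) {f h : unitInterval → Mom → ℝ}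
    (hf : Measurable (Function.uncurry f)) (hh : Measurable (Function.uncurry h)) :
    rieszForm (fun p => √(energy p) * expWeight k p) (supNorm f) (supNorm h)
      ≤ negNorm k h * weightedNorm k f :=
  rieszForm_le (by fun_prop) (measurable_supNorm hf) (measurable_supNorm hh)
    fun p => mul_nonneg (Real.sqrt_nonneg _) (expWeight_pos k p).le

lemma IsHardSphereKernel.le_mul {A M : ℝ} (hA : 0 ≤ A) {σ : ℝ → ℝ → ℝ} {σ₀ : ℝ → ℝ}
    (hσ : IsHardSphereKernel A M σ σ₀) {g θ : ℝ} (hg : 0 ≤ g) (hθ : θ ∈ Set.Icc 0 Real.pi) :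
    σ g θ ≤ A * M * g :=
  calc σ g θ ≤ A * (g * σ₀ θ) := hσ.upper g hg θ hθ
    _ ≤ A * (g * M) := by gcongr; exact hσ.angular_le θ hθ
    _ = A * M * g := by ring

end GainEstimate

end RelBoltzmann

end

open RelBoltzmann in
theorem lemma3p2_general :
    ∃ C : ℝ, 0 < C ∧
      ∀ (σ : ℝ → ℝ → ℝ) (B : ℝ), (∀ g, 0 ≤ g → ∀ θ ∈ Set.Icc 0 Real.pi, σ g θ ≤ B * g) →
      ∀ k : ℝ, 0 < k →
      ∀ f h : unitInterval → Mom → ℝ,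
        Measurable (Function.uncurry f) → Measurable (Function.uncurry h) →
        (∀ x p, 0 ≤ f x p) → (∀ x p, 0 ≤ h x p) →
        (∫⁻ p : Mom, ENNReal.ofReal (expWeight k p) * supNorm (gain σ f h) p
            ≤ ENNReal.ofReal (C * B * k⁻¹) * negNorm k f * weightedNorm k h) ∧
        (∫⁻ p : Mom, ENNReal.ofReal (expWeight k p) * supNorm (gain σ f h) p
            ≤ ENNReal.ofReal (C * B * k⁻¹) * negNorm k h * weightedNorm k f) := by
  obtain ⟨C, hC, hgain⟩ := exists_lintegral_expWeight_mul_supNorm_gain_le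
  refine ⟨C, hC, fun σ B hσ k hk f h hf hh hf0 hh0 => ?_⟩
  have hriesz := hgain σ B hσ k hk f h hf hh hf0 hh0
  have hsymm := rieszForm_comm (W := fun p => √(energy p) * expWeight k p) (by fun_prop)
    (measurable_supNorm hf) (measurable_supNorm hh)
  rw [mul_assoc (ENNReal.ofReal _), mul_assoc (ENNReal.ofReal _)]
  constructor
  · rw [hsymm] at hriesz
    exact hriesz.trans (mul_le_mul_right (rieszForm_supNorm_le k hh hf) _)
  · exact hriesz.trans (mul_le_mul_right (rieszForm_supNorm_le k hf hh) _)

open RelBoltzmann in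
theorem lemma3p2 (A M : ℝ) (hA : 0 < A) (hM : 0 < M) :
    ∃ C : ℝ, 0 < C ∧
      ∀ (σ : ℝ → ℝ → ℝ) (σ₀ : ℝ → ℝ), IsHardSphereKernel A M σ σ₀ →
      ∀ k : ℝ, 0 < k →
      ∀ f h : unitInterval → Mom → ℝ,
        Measurable (Function.uncurry f) → Measurable (Function.uncurry h) →
        (∀ x p, 0 ≤ f x p) → (∀ x p, 0 ≤ h x p) →
        (∫⁻ p : Mom, ENNReal.ofReal (expWeight k p) * supNorm (gain σ f h) p
            ≤ ENNReal.ofReal (C * k⁻¹) * negNorm k f * weightedNorm k h) ∧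
        (∫⁻ p : Mom, ENNReal.ofReal (expWeight k p) * supNorm (gain σ f h) p
            ≤ ENNReal.ofReal (C * k⁻¹) * negNorm k h * weightedNorm k f) := by
  obtain ⟨C, hC, hgain⟩ := lemma3p2_general
  exact ⟨C * (A * M), by positivity, fun σ _ hσ =>
    hgain σ (A * M) fun _ hg _ hθ => hσ.le_mul hA.le hg hθ⟩
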